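/- Notation. For $f:\mathbb{R}^m\to\mathbb{R}\cup\{\pm\infty\}$, write $\operatorname{dom} f=\{x: f(x)\in\mathbb{R}\}$, $f^*(p)=\sup_x\,(\langle p,x\rangle-f(x))$ and $\partial f(x)=\{p: f(y)\ge f(x)+\langle p,y-x\rangle\ \forall y\}$. $\Gamma_0(\mathbb{R}^m)$ is the set of proper, convex, lower semicontinuous functions $\mathbb{R}^m\to\mathbb{R}\cup\{+\infty\}$, and $\Gamma_0(\mathbb{R}^n\times[0,\infty)^N)$ is the set of those elements of $\Gamma_0(\mathbb{R}^{n+N})$ that equal $+\infty$ outside $\mathbb{R}^n\times[0,\infty)^N$. $\operatorname{ri}$ denotes the relative interior, and $I\{\cdot\}$ is $0$ if the condition in braces holds and $+\infty$ otherwise. Let $J\in\Gamma_0(\mathbb{R}^n)$ and let $H_1,\dots,H_N:\mathbb{R}^n\to\mathbb{R}\cup\{\pm\infty\}$ be arbitrary functions. Call $S\in\Gamma_0(\mathbb{R}^n\times[0,\infty)^N)$ a *convex solution* if (i) whenever $p\in\mathbb{R}^n$ and $E_1,\dots,E_N\in\mathbb{R}$ satisfy $(p,E_1,\dots,E_N)\in\partial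 S(x,t_1,\dots,t_N)$ for some $x\in\mathbb{R}^n$ and $t_1,\dots,t_N>0$, then $E_j+H_j(p)=0$ for every $j=1,\dots,N$; (ii) $S(x,0,\dots,0)=J(x)$ for every $x\in\mathbb{R}^n$. 1. Let $N=1$ and $H=H_1$. If $S$ is a convex solution with $S(x,t)\neq+\infty$ for some $x\in\mathbb{R}^n$ and $t>0$, then $S$ is the only convex solution with this property, and $S=F^*$, where $$F(p,E)=J^*(p)+I\{E\le -H(p)\}+I\{p\in\operatorname{ri}\operatorname{dom}J^*\},\qquad p\in\mathbb{R}^n,\ E\in\mathbb{R}.$$ Moreover, the restriction of $H$ to $\operatorname{ri}\operatorname{dom}J^*$ is finite-valued and convex. 2. Let $N>1$. If $S$ is a convex solution with $S(x,t_1,\dots,t_N)\neq+\infty$ for some $x\in\mathbb{R}^n$ and $t_1,\dots,t_N>0$, and $\tilde S$ is a convex solution with $\operatorname{ri}\operatorname{dom}\tilde S=\operatorname{ri}\operatorname{dom}S$, then $\tilde S=S$. -/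

import Mathlib

open scoped RealInnerProductSpace

/-- `dom f`: the points where the extended-valued function `f` takes a real value. -/
def effDom {V : Type*} (f : V → EReal) : Set V := {x | ∃ r : ℝ, f x = (r : EReal)}

/-- `Γ₀(V)`: proper, convex, lower semicontinuous functions `V → ℝ ∪ {+∞}`. -/
structure GammaZero {V : Type*} [NormedAddCommGroup V] [InnerProductSpace ℝ V]
    (f : V → EReal) : Prop where
  ne_bot : ∀ x, f x ≠ ⊥
  proper : ∃ x, f x ≠ ⊤
  convex : ∀ x y : V, ∀ a : ℝ, 0 < a → a < 1 →
    f (a • x + (1 - a) • y) ≤ (a : EReal) * f x + ((1 - a : ℝ) : EReal) * f y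
  lsc : LowerSemicontinuous f

/-- The Legendre transform `f^*(p) = sup_x (⟨p, x⟩ - f x)`. -/
noncomputable def legendre {V : Type*} [NormedAddCommGroup V] [InnerProductSpace ℝ V]
    (f : V → EReal) (p : V) : EReal :=
  ⨆ x : V, ((⟪p, x⟫ : ℝ) : EReal) - f x

/-- The subdifferential `∂f(x)`. -/
def subdiff {V : Type*} [NormedAddCommGroup V] [InnerProductSpace ℝ V]
    (f : V → EReal) (x : V) : Set V :=
  {p | ∀ y : V, f x + ((⟪p, y - x⟫ : ℝ) : EReal) ≤ f y}

open Classical in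
/-- The indicator `I{P}`, equal to `0` if `P` holds and to `+∞` otherwise. -/
noncomputable def indic (P : Prop) : EReal := if P then 0 else ⊤

/-- The Euclidean space `ℝⁿ × ℝᴺ = ℝⁿ⁺ᴺ`, with inner product
`⟨(p, E), (x, t)⟩ = ⟨p, x⟩ + ∑ⱼ Eⱼ tⱼ`. -/
abbrev SpaceTime (n N : ℕ) : Type :=
  WithLp 2 (EuclideanSpace ℝ (Fin n) × EuclideanSpace ℝ (Fin N))

/-- The point `(x, t)` of `ℝⁿ × ℝᴺ`. -/
def stPoint {n N : ℕ} (x : EuclideanSpace ℝ (Fin n)) (t : EuclideanSpace ℝ (Fin N)) :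
    SpaceTime n N := WithLp.toLp 2 (x, t)

/-- `S` belongs to `Γ₀(ℝⁿ × [0, ∞)ᴺ)` (with `S` extended by `+∞` to `ℝⁿ × ℝᴺ`), its subgradients
at positive times satisfy the multi-time Hamilton-Jacobi relations with the Hamiltonians `H j`,
and it equals `J` at time zero. -/
structure IsConvexHJSolution {n N : ℕ} (J : EuclideanSpace ℝ (Fin n) → EReal)
    (H : Fin N → EuclideanSpace ℝ (Fin n) → EReal) (S : SpaceTime n N → EReal) : Prop where
  gamma : GammaZero S
  eq_top : ∀ x t, (∃ j, t j < 0) → S (stPoint x t) = ⊤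
  hj : ∀ p E x t, (∀ j, 0 < t j) → stPoint p E ∈ subdiff S (stPoint x t) →
    ∀ j, ((E j : ℝ) : EReal) + H j p = 0
  initial : ∀ x, S (stPoint x 0) = J x

/-- `S` is finite (not `+∞`) at some point all of whose times are positive. -/
def FiniteAtPositiveTime {n N : ℕ} (S : SpaceTime n N → EReal) : Prop :=
  ∃ x t, (∀ j, 0 < t j) ∧ S (stPoint x t) ≠ ⊤

/-- `F(p, E) = J^*(p) + I{E ≤ -H(p)} + I{p ∈ ri dom J^*}` on `ℝⁿ × ℝ`. -/
noncomputable def hopfDual {n : ℕ} (J H : EuclideanSpace ℝ (Fin n) → EReal)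
    (q : SpaceTime n 1) : EReal :=
  legendre J q.fst + indic (((q.snd 0 : ℝ) : EReal) ≤ -H q.fst)
    + indic (q.fst ∈ intrinsicInterior ℝ (effDom (legendre J)))

/-!
For a single time everything is read off the Legendre transform `S^*`. Since `S` is infinite at
negative times, `S^*(p, E)` is nondecreasing in the energy `E`, and since `S(·, 0) = J`, it is
bounded below by `J^*(p)`. Let `p` be in the relative interior of `dom J^*`, which lies in the
relative interior of the projection of `dom S^*` (`ri_effDom_subset_ri_momenta`), so that supporting
hyperplanes exist. A supporting hyperplane of `S^*` at `(p, E)` with normal `(x, t)`, `t > 0`, is a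
subgradient `(p, E)` of `S` at `(x, t)`, so the Hamilton–Jacobi relation forces `E = -H(p)`. Thus
`S^*(p, ·)` can have a positive slope at one energy only; it is constant, equal to `J^*(p)`, on the
half-line where it is finite (`legendre_le_of_finite`). This half-line is bounded, because `S` is
finite at a positive time, and closed, and its endpoint carries a supporting line of slope one, so
it is `E ≤ -H(p)` (`exists_energy`). Hence `S^*` agrees with the Hopf dual above the relative
interior of `dom J^*`, and the values of `S^*` there determine `S` by convexity and the
Fenchel–Moreau theorem (`eq_legendre_hopfDual`). Convexity of `dom S^*` gives that of `H`.

For several times, the restriction of `S` to a ray of times through the relative interior of `dom S`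
is a single-time solution for the corresponding combination of the Hamiltonians, by the chain rule
for subgradients (`exists_subdiff_of_comp`, `comp_rayMap`). Single-time uniqueness on all these rays
identifies two solutions on the common relative interior of their domains, and lower semicontinuity
along segments does the rest.

Supporting hyperplanes all come from `Convex.exists_inner_le_snd`, a Hahn–Banach theorem for a
convex set `G ⊆ V × ℝ` whose projection to `V` has `0` in its relative interior. Applied to the
epigraph of a marginal function, it yields subgradients, extensions of supporting lines, and the
chain rule.
-/

/-! ### The relative interior of a convex set -/

section RelativeInterior

variable {V : Type*} [NormedAddCommGroup V] [NormedSpace ℝ V] {C : Set V}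

theorem mem_intrinsicInterior_iff_dist {x : V} :
    x ∈ intrinsicInterior ℝ C ↔
      x ∈ C ∧ ∃ ε > 0, ∀ y ∈ affineSpan ℝ C, dist y x < ε → y ∈ C := by
  constructor
  · intro hx
    refine ⟨intrinsicInterior_subset hx, ?_⟩
    obtain ⟨y, hy, rfl⟩ := mem_intrinsicInterior.1 hx
    obtain ⟨ε, hε, h⟩ := Metric.mem_nhds_iff.1 (mem_interior_iff_mem_nhds.1 hy)
    exact ⟨ε, hε, fun z hz hd => h (show (⟨z, hz⟩ : affineSpan ℝ C) ∈ Metric.ball y ε from hd)⟩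
  · rintro ⟨hx, ε, hε, h⟩
    refine mem_intrinsicInterior.2
      ⟨⟨x, subset_affineSpan ℝ C hx⟩, mem_interior_iff_mem_nhds.2 ?_, rfl⟩
    exact Metric.mem_nhds_iff.2 ⟨ε, hε, fun z hz => h z z.2 hz⟩

/-- The line segment principle: moving from a relatively interior point of a convex set towards a
point of the closure, one stays in the relative interior until the endpoint. -/
theorem Convex.combo_intrinsicInterior_closure_mem [FiniteDimensional ℝ V] (hC : Convex ℝ C)
    {z y : V} (hz : z ∈ intrinsicInterior ℝ C) (hy : y ∈ closure C) {a b : ℝ} (ha : 0 < a)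
    (hb : 0 ≤ b) (hab : a + b = 1) : a • z + b • y ∈ intrinsicInterior ℝ C := by
  obtain ⟨hzC, ε, hε, hball⟩ := mem_intrinsicInterior_iff_dist.1 hz
  obtain rfl : b = 1 - a := by linarith
  -- A point `w` near `a • z + b • y` is `a • z' + b • y'` with `y' ∈ C` near `y`; then `z'` is near
  -- `z`, so it lies in `C`.
  have key : ∀ w ∈ affineSpan ℝ C, dist w (a • z + (1 - a) • y) < a * ε / 2 → w ∈ C := by
    intro w hw hd
    obtain ⟨y', hy', hyy⟩ := Metric.mem_closure_iff.1 hy (a * ε / 2) (by positivity)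
    have hz' : a⁻¹ • (w - y') + y' ∈ affineSpan ℝ C := by
      simpa [AffineMap.lineMap_apply] using
        AffineMap.lineMap_mem a⁻¹ (subset_affineSpan ℝ C hy') hw
    have hw' : w = a • (a⁻¹ • (w - y') + y') + (1 - a) • y' := by
      match_scalars <;> field_simp; ring
    have hmem : a⁻¹ • (w - y') + y' ∈ C := by
      refine hball _ hz' ?_
      have : a⁻¹ • (w - y') + y' - z =
          a⁻¹ • ((w - (a • z + (1 - a) • y)) + (1 - a) • (y - y')) := by
        match_scalars <;> field_simp <;> ring
      rw [dist_eq_norm, this, norm_smul, norm_inv, Real.norm_of_nonneg ha.le,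
        inv_mul_lt_iff₀ ha]
      calc _ ≤ ‖w - (a • z + (1 - a) • y)‖ + ‖(1 - a) • (y - y')‖ := norm_add_le _ _
        _ ≤ ‖w - (a • z + (1 - a) • y)‖ + ‖y - y'‖ := by
          gcongr
          rw [norm_smul, Real.norm_of_nonneg hb]
          exact mul_le_of_le_one_left (norm_nonneg _) (by linarith)
        _ < a * ε := by rw [dist_eq_norm] at hd hyy; linarith
    rw [hw']
    exact hC hmem hy' ha.le hb hab
  have hspan : a • z + (1 - a) • y ∈ affineSpan ℝ C := by
    have hy' : y ∈ affineSpan ℝ C :=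
      closure_minimal (subset_affineSpan ℝ C) (affineSpan ℝ C).closed_of_finiteDimensional hy
    have := AffineMap.lineMap_mem a hy' (subset_affineSpan ℝ C hzC)
    rwa [AffineMap.lineMap_apply_module, add_comm] at this
  exact mem_intrinsicInterior_iff_dist.2
    ⟨key _ hspan (by rw [dist_self]; positivity), _, by positivity, key⟩

theorem Convex.intrinsicInterior [FiniteDimensional ℝ V] (hC : Convex ℝ C) :
    Convex ℝ (intrinsicInterior ℝ C) := by
  intro x hx y hy a b ha hb hab
  rcases ha.eq_or_lt with rfl | ha
  · obtain rfl : b = 1 := by linarith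
    simpa using hy
  · exact hC.combo_intrinsicInterior_closure_mem hx
      (subset_closure (intrinsicInterior_subset hy)) ha hb hab

/-- A segment ending at a relatively interior point can be prolonged inside the set. -/
theorem exists_prolongation_mem {x y : V} (hx : x ∈ intrinsicInterior ℝ C)
    (hy : y ∈ C) : ∃ s : ℝ, 0 < s ∧ x - s • (y - x) ∈ C := by
  obtain ⟨hxC, ε, hε, h⟩ := mem_intrinsicInterior_iff_dist.1 hx
  refine ⟨ε / (2 * (‖y - x‖ + 1)), by positivity, h _ ?_ ?_⟩
  · have := AffineMap.lineMap_mem (-(ε / (2 * (‖y - x‖ + 1)))) (subset_affineSpan ℝ C hxC)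
      (subset_affineSpan ℝ C hy)
    rw [AffineMap.lineMap_apply, vsub_eq_sub, vadd_eq_add] at this
    convert this using 1
    module
  · rw [dist_eq_norm, sub_sub_cancel_left, norm_neg, norm_smul,
      Real.norm_of_nonneg (by positivity), div_mul_eq_mul_div, div_lt_iff₀ (by positivity)]
    nlinarith [norm_nonneg (y - x)]

/-- Adding points of its closure to a convex set does not enlarge the relative interior. -/
theorem Convex.intrinsicInterior_subset_of_subset_closure [FiniteDimensional ℝ V]
    (hC : Convex ℝ C) (hne : C.Nonempty) {Q : Set V} (hCQ : C ⊆ Q) (hQ : Q ⊆ closure C) :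
    _root_.intrinsicInterior ℝ Q ⊆ _root_.intrinsicInterior ℝ C := by
  intro p hp
  obtain ⟨z, hz⟩ := hne.intrinsicInterior hC
  -- `p` lies strictly between `z` and a point of `Q` beyond `p`.
  obtain ⟨s, hs, hsQ⟩ := exists_prolongation_mem hp (hCQ (intrinsicInterior_subset hz))
  have := hC.combo_intrinsicInterior_closure_mem hz (hQ hsQ) (a := s / (1 + s))
    (b := 1 / (1 + s)) (by positivity) (by positivity) (by field_simp; ring)
  convert this using 1
  match_scalars <;> field_simp <;> ring

end RelativeInterior

/-! ### Supporting convex sets at relatively interior points -/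

section HahnBanach

variable {V : Type*} [NormedAddCommGroup V] [InnerProductSpace ℝ V]

/-- Supporting a convex set `G ⊆ V × ℝ` from below at the origin by a linear function. Instead of
an interiority assumption, the projection of `G` to `V` is only required to be symmetric around the
origin up to scaling, that is, `0` lies in its relative interior. -/
theorem Convex.exists_inner_le_snd [FiniteDimensional ℝ V] {G : Set (V × ℝ)} (hG : Convex ℝ G)
    (h0 : ∀ r, ((0 : V), r) ∈ G → 0 ≤ r)
    (hcore : ∀ g ∈ G, ∃ s : ℝ, 0 < s ∧ ∃ r, (-s • g.1, r) ∈ G) :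
    ∃ x : V, ∀ g ∈ G, ⟪x, g.1⟫ ≤ g.2 := by
  rcases G.eq_empty_or_nonempty with rfl | ⟨g₀, hg₀⟩
  · exact ⟨0, by simp⟩
  -- The cone generated by the projection of `G` is a linear subspace `D`.
  have add_mem : ∀ {c c' : ℝ} {g g' : V × ℝ}, 0 ≤ c → 0 ≤ c' → 0 < c + c' → g ∈ G → g' ∈ G →
      ∃ k ∈ G, (c + c') • k = c • g + c' • g' := by
    intro c c' g g' hc hc' hcc hg hg'
    refine ⟨_, hG hg hg' (div_nonneg hc hcc.le) (div_nonneg hc' hcc.le)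
      (by rw [← add_div, div_self hcc.ne']), ?_⟩
    rw [smul_add, smul_smul, smul_smul, mul_div_cancel₀ _ hcc.ne', mul_div_cancel₀ _ hcc.ne']
  let D : Submodule ℝ V :=
    { carrier := {d | ∃ c : ℝ, 0 < c ∧ ∃ g ∈ G, d = c • g.1}
      zero_mem' := by
        obtain ⟨s, hs, r, hr⟩ := hcore g₀ hg₀
        obtain ⟨k, hk, hk'⟩ := add_mem hs.le zero_le_one (by positivity) hg₀ hr
        refine ⟨s + 1, by positivity, k, hk, ?_⟩
        have := congrArg Prod.fst hk'
        simp only [Prod.smul_fst, Prod.fst_add] at this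
        rw [this]; simp
      add_mem' := by
        rintro _ _ ⟨c, hc, g, hg, rfl⟩ ⟨c', hc', g', hg', rfl⟩
        obtain ⟨k, hk, hk'⟩ := add_mem hc.le hc'.le (by positivity) hg hg'
        exact ⟨c + c', by positivity, k, hk, (congrArg Prod.fst hk').symm⟩
      smul_mem' := by
        rintro a _ ⟨c, hc, g, hg, rfl⟩
        obtain ⟨s, hs, r, hr⟩ := hcore g hg
        rcases lt_trichotomy a 0 with ha | rfl | ha
        · refine ⟨-a * c / s, by have := neg_pos.2 ha; positivity, _, hr, ?_⟩
          match_scalars; field_simp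
        · obtain ⟨k, hk, hk'⟩ := add_mem hs.le zero_le_one (by positivity) hg hr
          refine ⟨s + 1, by positivity, k, hk, ?_⟩
          have := congrArg Prod.fst hk'
          simp only [Prod.smul_fst, Prod.fst_add] at this
          rw [this]; simp
        · exact ⟨a * c, by positivity, g, hg, by rw [smul_smul]⟩ }
  have hGD : ∀ g ∈ G, g.1 ∈ D := fun g hg => ⟨1, one_pos, g, hg, by simp⟩
  let K : PointedCone ℝ (D × ℝ) :=
    { carrier := {y | ∃ c : ℝ, 0 ≤ c ∧ ∃ g ∈ G, (y.1 : V) = c • g.1 ∧ c * g.2 ≤ y.2}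
      zero_mem' := ⟨0, le_rfl, g₀, hg₀, by simp⟩
      add_mem' := by
        rintro y y' ⟨c, hc, g, hg, h1, h2⟩ ⟨c', hc', g', hg', h1', h2'⟩
        rcases (add_nonneg hc hc').eq_or_lt with h | h
        · obtain rfl : c = 0 := by linarith
          obtain rfl : c' = 0 := by linarith
          refine ⟨0, le_rfl, g₀, hg₀, by simp [h1, h1'], ?_⟩
          simp only [zero_mul, Prod.snd_add] at *
          linarith
        · obtain ⟨k, hk, hk'⟩ := add_mem hc hc' h hg hg'
          refine ⟨c + c', h.le, k, hk, ?_, ?_⟩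
          · simp only [Prod.fst_add, Submodule.coe_add, h1, h1']
            exact (congrArg Prod.fst hk').symm
          · have := congrArg Prod.snd hk'
            simp only [Prod.smul_snd, Prod.snd_add, smul_eq_mul] at this ⊢
            linarith
      smul_mem' := by
        rintro ⟨a, ha⟩ y ⟨c, hc, g, hg, h1, h2⟩
        refine ⟨a * c, mul_nonneg ha hc, g, hg, ?_, ?_⟩
        · change a • (y.1 : V) = _
          rw [h1, smul_smul]
        · change _ ≤ a * y.2
          rw [mul_assoc]
          exact mul_le_mul_of_nonneg_left h2 ha }
  let f : (D × ℝ) →ₗ.[ℝ] ℝ :=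
    { domain := (⊥ : Submodule ℝ D).prod ⊤
      toFun := (LinearMap.snd ℝ D ℝ).comp (Submodule.subtype _) }
  obtain ⟨φ, hφ, hφK⟩ := riesz_extension K f
    (by
      rintro ⟨⟨d, r⟩, hd⟩ ⟨c, hc, g, hg, h1, h2⟩
      obtain rfl : d = 0 := by simpa [f] using hd
      change 0 ≤ r
      rcases hc.eq_or_lt with rfl | hc
      · simpa using h2
      · have hg0 : g.1 = 0 := by simpa [hc.ne'] using h1.symm
        have := h0 g.2 (by rw [← hg0]; exact hg)
        exact (mul_nonneg hc.le this).trans h2)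
    (by
      rintro ⟨⟨d, c, hc, g, hg, rfl⟩, r⟩
      refine ⟨⟨(0, c * g.2 - r), by simp [f]⟩, c, hc.le, g, hg, ?_, ?_⟩
      · simp
      · simp)
  obtain ⟨ψ, hψ⟩ := (-(φ.comp (LinearMap.inl ℝ D ℝ))).exists_extend
  refine ⟨(InnerProductSpace.toDual ℝ V).symm ψ.toContinuousLinearMap, fun g hg => ?_⟩
  rw [InnerProductSpace.toDual_symm_apply]
  have h1 : ψ g.1 = -φ (⟨g.1, hGD g hg⟩, 0) := by
    have := congrArg (fun l => l ⟨g.1, hGD g hg⟩) hψ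
    simpa using this
  have h2 : φ (0, g.2) = g.2 := hφ ⟨(0, g.2), by simp [f]⟩
  have h3 : 0 ≤ φ (⟨g.1, hGD g hg⟩, g.2) := hφK _ ⟨1, zero_le_one, g, hg, by simp, by simp⟩
  have h4 : φ (⟨g.1, hGD g hg⟩, g.2) = φ (⟨g.1, hGD g hg⟩, 0) + φ (0, g.2) := by
    rw [← map_add]; simp
  change ψ g.1 ≤ g.2
  linarith

end HahnBanach

/-! ### Extended-valued convex functions -/

section ExtendedValued

theorem EReal.le_iff_forall_coe {a b : EReal} : a ≤ b ↔ ∀ c : ℝ, b ≤ c → a ≤ c :=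
  ⟨fun h _ hc => h.trans hc, fun h => EReal.le_of_forall_lt_iff_le.1 fun z hz => h z hz.le⟩

theorem EReal.coe_add_eq_zero_iff {b : ℝ} {a : EReal} :
    (b : EReal) + a = 0 ↔ a = ((-b : ℝ) : EReal) := by
  induction a with
  | bot => simp [-EReal.coe_neg]
  | top => simp [-EReal.coe_neg]
  | coe a =>
    rw [← EReal.coe_add, EReal.coe_eq_zero, EReal.coe_eq_coe_iff]
    constructor <;> intro h <;> linarith

theorem mem_effDom_iff {V : Type*} {f : V → EReal} {x : V} (hx : f x ≠ ⊥) :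
    x ∈ effDom f ↔ ∃ r : ℝ, f x ≤ r := by
  refine ⟨fun ⟨r, hr⟩ => ⟨r, hr.le⟩, fun ⟨r, hr⟩ => ⟨(f x).toReal, ?_⟩⟩
  exact (EReal.coe_toReal (ne_top_of_le_ne_top (EReal.coe_ne_top r) hr) hx).symm

/-- The epigraph of `f`, as a subset of `V × ℝ`. Inequalities between extended-valued functions are
expressed through it, so that all arithmetic takes place in `ℝ`. -/
def epigraph {V : Type*} (f : V → EReal) : Set (V × ℝ) := {z | f z.1 ≤ z.2}

variable {V : Type*} [NormedAddCommGroup V] [InnerProductSpace ℝ V] {f : V → EReal}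

theorem Convex.le_combo (hf : Convex ℝ (epigraph f)) {x y : V} {r s a b : ℝ} (hx : f x ≤ r)
    (hy : f y ≤ s) (ha : 0 ≤ a) (hb : 0 ≤ b) (hab : a + b = 1) :
    f (a • x + b • y) ≤ ((a * r + b * s : ℝ) : EReal) :=
  hf (x := (x, r)) hx (y := (y, s)) hy ha hb hab

theorem GammaZero.convex_epigraph (hf : GammaZero f) : Convex ℝ (epigraph f) := by
  refine convex_iff_forall_pos.2 ?_
  rintro ⟨x, r⟩ hx ⟨y, s⟩ hy a b ha hb hab
  obtain rfl : b = 1 - a := by linarith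
  have ha' : (0 : EReal) ≤ a := by exact_mod_cast ha.le
  have hb' : (0 : EReal) ≤ ((1 - a : ℝ) : EReal) := by exact_mod_cast hb.le
  calc f (a • x + (1 - a) • y) ≤ a * f x + ((1 - a : ℝ) : EReal) * f y :=
        hf.convex x y a ha (by linarith)
    _ ≤ a * (r : EReal) + ((1 - a : ℝ) : EReal) * (s : EReal) :=
        add_le_add (mul_le_mul_of_nonneg_left hx ha') (mul_le_mul_of_nonneg_left hy hb')
    _ = ((a * r + (1 - a) * s : ℝ) : EReal) := by push_cast; rfl

theorem convex_effDom (hf : Convex ℝ (epigraph f)) (hbot : ∀ x, f x ≠ ⊥) :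
    Convex ℝ (effDom f) := by
  intro x hx y hy a b ha hb hab
  rw [mem_effDom_iff (hbot _)] at *
  obtain ⟨r, hr⟩ := hx
  obtain ⟨s, hs⟩ := hy
  exact ⟨_, hf.le_combo hr hs ha hb hab⟩

theorem GammaZero.effDom_nonempty (hf : GammaZero f) : (effDom f).Nonempty := by
  obtain ⟨x, hx⟩ := hf.proper
  exact ⟨x, (f x).toReal, (EReal.coe_toReal hx (hf.ne_bot x)).symm⟩

/-- A bound that holds along a segment, affinely interpolated, persists at the endpoint. -/
theorem LowerSemicontinuous.le_of_segment (hf : LowerSemicontinuous f) {x₀ x : V} {a b : ℝ}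
    (h : ∀ s : ℝ, 0 < s → s < 1 →
      f ((1 - s) • x₀ + s • x) ≤ (((1 - s) * a + s * b : ℝ) : EReal)) : f x ≤ b := by
  by_contra! hlt
  obtain ⟨c, hbc, hcx⟩ := EReal.lt_iff_exists_real_btwn.1 hlt
  have hbc : b < c := by exact_mod_cast hbc
  have h1 : Filter.Tendsto (fun s : ℝ => (1 - s) • x₀ + s • x) (nhdsWithin 1 (Set.Iio 1))
      (nhds x) := by
    have : Continuous fun s : ℝ => (1 - s) • x₀ + s • x := by fun_prop
    simpa using (this.tendsto 1).mono_left nhdsWithin_le_nhds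
  have h2 : Filter.Tendsto (fun s : ℝ => (1 - s) * a + s * b) (nhdsWithin 1 (Set.Iio 1))
      (nhds b) := by
    have : Continuous fun s : ℝ => (1 - s) * a + s * b := by fun_prop
    simpa using (this.tendsto 1).mono_left nhdsWithin_le_nhds
  obtain ⟨s, ⟨hs1, hs2⟩, hs3, hs4⟩ := (((h1.eventually (hf x c hcx)).and
    (h2.eventually (gt_mem_nhds hbc))).and
      (Ioo_mem_nhdsLT (zero_lt_one (α := ℝ)))).exists
  have := hs1.trans_le (h s hs3 hs4)
  exact lt_asymm hs2 (by exact_mod_cast this)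

/-- Membership in the subdifferential, tested on the epigraph. -/
theorem mem_subdiff_iff {x p : V} {r : ℝ} (hx : f x = r) :
    p ∈ subdiff f x ↔ ∀ v (c : ℝ), f v ≤ c → r + ⟪p, v - x⟫ ≤ c := by
  refine forall_congr' fun v => ?_
  rw [hx, EReal.le_iff_forall_coe]
  refine forall_congr' fun c => imp_congr_right fun _ => ?_
  rw [← EReal.coe_add, EReal.coe_le_coe_iff]

/-- A convex function has a subgradient at each point around which its domain is symmetric up to
scaling. -/
theorem exists_subgradient_of_core [FiniteDimensional ℝ V] (hf : Convex ℝ (epigraph f)) {x : V}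
    {r : ℝ} (hx : f x = r)
    (hcore : ∀ v (c : ℝ), f v ≤ c → ∃ s : ℝ, 0 < s ∧ ∃ c' : ℝ, f (x - s • (v - x)) ≤ c') :
    ∃ p : V, ∀ v (c : ℝ), f v ≤ c → r + ⟪p, v - x⟫ ≤ c := by
  obtain ⟨p, hp⟩ := Convex.exists_inner_le_snd (G := {g : V × ℝ | f (x + g.1) ≤ ((r + g.2 : ℝ))})
    (by
      rintro ⟨u, c⟩ hu ⟨u', c'⟩ hu' a b ha hb hab
      have := hf.le_combo hu hu' ha hb hab
      obtain rfl : b = 1 - a := by linarith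
      change f (x + (a • u + (1 - a) • u')) ≤ ((r + (a * c + (1 - a) * c') : ℝ) : EReal)
      convert this using 2
      · module
      · ring)
    (by
      intro c hc
      simp only [Set.mem_ofPred_eq, add_zero, hx, EReal.coe_le_coe_iff] at hc
      linarith)
    (by
      rintro ⟨u, c⟩ hu
      obtain ⟨s, hs, c', hc'⟩ := hcore _ _ hu
      refine ⟨s, hs, c' - r, ?_⟩
      change f (x + -s • u) ≤ ((r + (c' - r) : ℝ) : EReal)
      convert hc' using 2
      · simp only [add_sub_cancel_left]; module
      · ring)
  refine ⟨p, fun v c hv => ?_⟩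
  have := hp (v - x, c - r) (by
    change f (x + (v - x)) ≤ ((r + (c - r) : ℝ) : EReal)
    simpa using hv)
  simp only at this
  linarith

theorem exists_subgradient [FiniteDimensional ℝ V] (hf : Convex ℝ (epigraph f))
    (hbot : ∀ x, f x ≠ ⊥) {x : V} {r : ℝ} (hx : f x = r)
    (hri : x ∈ intrinsicInterior ℝ (effDom f)) :
    ∃ p : V, ∀ v (c : ℝ), f v ≤ c → r + ⟪p, v - x⟫ ≤ c := by
  refine exists_subgradient_of_core hf hx fun v c hv => ?_
  obtain ⟨s, hs, h⟩ := exists_prolongation_mem hri ((mem_effDom_iff (hbot v)).2 ⟨c, hv⟩)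
  exact ⟨s, hs, (mem_effDom_iff (hbot _)).1 h⟩

end ExtendedValued

/-! ### The Legendre transform and the Fenchel–Moreau theorem -/

section Legendre

variable {V : Type*} [NormedAddCommGroup V] [InnerProductSpace ℝ V] {f : V → EReal}

theorem legendre_le_coe_iff {q : V} {r : ℝ} :
    legendre f q ≤ r ↔ ∀ v (c : ℝ), f v ≤ c → ⟪q, v⟫ - c ≤ r := by
  rw [legendre, iSup_le_iff]
  refine forall_congr' fun v => ?_
  induction h : f v with
  | bot =>
    simp only [EReal.sub_bot (EReal.coe_ne_bot _), bot_le, forall_true_left, top_le_iff,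
      EReal.coe_ne_top, false_iff, not_forall]
    exact ⟨⟪q, v⟫ - r - 1, by linarith⟩
  | coe a =>
    simp only [EReal.coe_le_coe_iff, ← EReal.coe_sub]
    exact ⟨fun h c hc => by linarith, fun h => h a le_rfl⟩
  | top => simp

theorem legendre_ne_bot {v : V} {c : ℝ} (hv : f v ≤ c) (q : V) : legendre f q ≠ ⊥ := by
  intro h
  have h' : legendre f q ≤ ((⟪q, v⟫ - c - 1 : ℝ) : EReal) := by rw [h]; exact bot_le
  have := legendre_le_coe_iff.1 h' v c hv
  linarith

theorem convex_epigraph_legendre (f : V → EReal) : Convex ℝ (epigraph (legendre f)) := by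
  rintro ⟨p, r⟩ hp ⟨q, s⟩ hq a b ha hb hab
  refine legendre_le_coe_iff.2 fun v c hv => ?_
  have h1 := mul_le_mul_of_nonneg_left (legendre_le_coe_iff.1 hp v c hv) ha
  have h2 := mul_le_mul_of_nonneg_left (legendre_le_coe_iff.1 hq v c hv) hb
  obtain rfl : b = 1 - a := by linarith
  simp only [Prod.fst_add, Prod.smul_fst, Prod.snd_add, Prod.smul_snd, smul_eq_mul,
    inner_add_left, real_inner_smul_left] at *
  linarith

variable [FiniteDimensional ℝ V]

/-- If `J` grows along each direction `x` at most like the support function of the convex set `P`,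
then its Legendre transform is infinite off the closure of `P`. -/
theorem mem_closure_of_legendre_le {J : V → EReal} {P : Set V} (hP : Convex ℝ P) {y : V} {j : ℝ}
    (hJ : ∀ x (α : ℝ), (∀ q ∈ P, ⟪x, q⟫ ≤ α) → ∀ s : ℝ, 0 ≤ s →
      J (y + s • x) ≤ ((j + s * α : ℝ) : EReal))
    {p : V} {r : ℝ} (hp : legendre J p ≤ r) : p ∈ closure P := by
  by_contra hcl
  obtain ⟨φ, α, hα, hαp⟩ := geometric_hahn_banach_closed_point hP.closure isClosed_closure hcl
  set x := (InnerProductSpace.toDual ℝ V).symm φ with hx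
  have hφ : ∀ v, ⟪x, v⟫ = φ v := fun v => InnerProductSpace.toDual_symm_apply
  have hgrow := hJ x α fun q hq => by rw [hφ]; exact (hα q (subset_closure hq)).le
  have hbound : ∀ s : ℝ, 0 ≤ s → s * (φ p - α) ≤ r + j - ⟪p, y⟫ := by
    intro s hs
    have := legendre_le_coe_iff.1 hp _ _ (hgrow s hs)
    rw [inner_add_right, real_inner_smul_right, real_inner_comm x p, hφ] at this
    linarith
  have hpos : 0 < φ p - α := by linarith
  have h0 := hbound 0 le_rfl
  have := hbound ((r + j - ⟪p, y⟫ + 1) / (φ p - α)) (by apply div_nonneg <;> linarith)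
  rw [div_mul_cancel₀ _ hpos.ne'] at this
  linarith

theorem GammaZero.exists_legendre_le (hf : GammaZero f) : ∃ p, ∃ r : ℝ, legendre f p ≤ r := by
  obtain ⟨x, hx⟩ := hf.effDom_nonempty.intrinsicInterior
    (convex_effDom hf.convex_epigraph hf.ne_bot)
  obtain ⟨r, hr⟩ := intrinsicInterior_subset hx
  obtain ⟨p, hp⟩ := exists_subgradient hf.convex_epigraph hf.ne_bot hr hx
  refine ⟨p, ⟪p, x⟫ - r, legendre_le_coe_iff.2 fun v c hv => ?_⟩
  have := hp v c hv
  rw [inner_sub_right] at this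
  linarith

/-- The Fenchel–Moreau theorem. At relatively interior points of the domain it holds by existence of
subgradients, off the closure of the domain both sides are `⊤`, and in between lower semicontinuity
along a segment coming from the relative interior decides. -/
theorem GammaZero.legendre_legendre (hf : GammaZero f) : legendre (legendre f) = f := by
  refine le_antisymm (fun x => ?_) (fun x => ?_) <;> refine EReal.le_iff_forall_coe.2 fun r hr => ?_
  · refine legendre_le_coe_iff.2 fun p d hp => ?_
    have := legendre_le_coe_iff.1 hp x r hr
    rw [real_inner_comm]
    linarith
  · have hdom := convex_effDom hf.convex_epigraph hf.ne_bot
    obtain ⟨x₀, hx₀⟩ := hf.effDom_nonempty.intrinsicInterior hdom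
    obtain ⟨r₀, hr₀⟩ := intrinsicInterior_subset hx₀
    obtain ⟨p₀, d₀, hp₀⟩ := hf.exists_legendre_le
    have hcl : x ∈ closure (effDom f) := by
      refine mem_closure_of_legendre_le hdom (y := p₀) (j := d₀) (fun u α hα s hs => ?_) hr
      refine legendre_le_coe_iff.2 fun v c hv => ?_
      have h1 := legendre_le_coe_iff.1 hp₀ v c hv
      have h2 := mul_le_mul_of_nonneg_left
        (hα v ((mem_effDom_iff (hf.ne_bot v)).2 ⟨c, hv⟩)) hs
      rw [inner_add_left, real_inner_smul_left]
      linarith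
    refine hf.lsc.le_of_segment (x₀ := x₀) (a := r₀) fun s hs hs1 => ?_
    have hmem := hdom.combo_intrinsicInterior_closure_mem hx₀ hcl (a := 1 - s) (b := s)
      (by linarith) hs.le (by ring)
    obtain ⟨ρ, hρ⟩ := intrinsicInterior_subset hmem
    obtain ⟨p, hp⟩ := exists_subgradient hf.convex_epigraph hf.ne_bot hρ hmem
    set w := (1 - s) • x₀ + s • x with hw
    have hpw : legendre f p ≤ ((⟪p, w⟫ - ρ : ℝ) : EReal) := legendre_le_coe_iff.2 fun v c hv => by
      have := hp v c hv
      rw [inner_sub_right] at this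
      linarith
    have h1 := legendre_le_coe_iff.1 hpw x₀ r₀ hr₀.le
    have h2 := legendre_le_coe_iff.1 hr p _ hpw
    have h3 : ⟪p, w⟫ = (1 - s) * ⟪p, x₀⟫ + s * ⟪p, x⟫ := by
      rw [hw, inner_add_right, real_inner_smul_right, real_inner_smul_right]
    rw [real_inner_comm] at h2
    rw [hρ, EReal.coe_le_coe_iff]
    nlinarith

/-- A subgradient `x` of the Legendre transform of `f` at `q` exhibits `q` as a subgradient of `f`
at `x`. -/
theorem GammaZero.mem_subdiff_of_legendre (hf : GammaZero f) {q x : V} {c : ℝ}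
    (hq : legendre f q ≤ c) (h : ∀ v (r : ℝ), legendre f v ≤ r → c + ⟪x, v - q⟫ ≤ r) :
    f x = ((⟪x, q⟫ - c : ℝ) : EReal) ∧ q ∈ subdiff f x := by
  have hx : f x = ((⟪x, q⟫ - c : ℝ) : EReal) := by
    apply le_antisymm
    · rw [← hf.legendre_legendre]
      refine legendre_le_coe_iff.2 fun v r hv => ?_
      have := h v r hv
      rw [inner_sub_right] at this
      linarith
    · refine EReal.le_iff_forall_coe.2 fun r hr => EReal.coe_le_coe_iff.2 ?_
      have := legendre_le_coe_iff.1 hq x r hr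
      rw [real_inner_comm] at this
      linarith
  refine ⟨hx, (mem_subdiff_iff hx).2 fun v r hv => ?_⟩
  have := legendre_le_coe_iff.1 hq v r hv
  rw [inner_sub_right, real_inner_comm q x]
  linarith

end Legendre

/-! ### The Legendre transform of a single-time solution -/

section SingleTime

variable {n : ℕ}

/-- The point `(x, t)` of `ℝⁿ × ℝ`, for a scalar time `t`. -/
noncomputable def timePoint (x : EuclideanSpace ℝ (Fin n)) (t : ℝ) : SpaceTime n 1 :=
  stPoint x (WithLp.toLp 2 fun _ => t)

theorem timePoint_fst_snd (q : SpaceTime n 1) : timePoint q.fst (q.snd 0) = q := by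
  obtain ⟨x, t⟩ := q
  unfold timePoint stPoint
  congr 2
  ext i
  rw [Subsingleton.elim i 0]
  rfl

theorem exists_timePoint (q : SpaceTime n 1) : ∃ x t, q = timePoint x t :=
  ⟨_, _, (timePoint_fst_snd q).symm⟩

theorem inner_timePoint (p x : EuclideanSpace ℝ (Fin n)) (e t : ℝ) :
    ⟪timePoint p e, timePoint x t⟫ = ⟪p, x⟫ + e * t := by
  simp [timePoint, stPoint, PiLp.inner_apply, mul_comm]

theorem timePoint_combo (p p' : EuclideanSpace ℝ (Fin n)) (e e' a b : ℝ) :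
    a • timePoint p e + b • timePoint p' e' =
      timePoint (a • p + b • p') (a * e + b * e') := by
  rfl

theorem timePoint_sub (p p' : EuclideanSpace ℝ (Fin n)) (e e' : ℝ) :
    timePoint p e - timePoint p' e' = timePoint (p - p') (e - e') := by
  rfl

theorem timePoint_zero (x : EuclideanSpace ℝ (Fin n)) : timePoint x 0 = stPoint x 0 := rfl

/-- The momenta `p` for which `f (p, e)` is finite for some energy `e`. -/
def momenta (f : SpaceTime n 1 → EReal) : Set (EuclideanSpace ℝ (Fin n)) :=
  {p | ∃ (e : ℝ) (r : ℝ), f (timePoint p e) ≤ r}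

theorem convex_momenta {f : SpaceTime n 1 → EReal} (hf : Convex ℝ (epigraph f)) :
    Convex ℝ (momenta f) := by
  rintro p ⟨e, r, h⟩ p' ⟨e', r', h'⟩ a b ha hb hab
  have := hf.le_combo h h' ha hb hab
  rw [timePoint_combo] at this
  exact ⟨_, _, this⟩

/-- Extending a supporting line in the energy variable at momentum `p` to a supporting hyperplane
in all variables. -/
theorem exists_inner_le_of_slice {f : SpaceTime n 1 → EReal} (hf : Convex ℝ (epigraph f))
    {p : EuclideanSpace ℝ (Fin n)} (hp : p ∈ intrinsicInterior ℝ (momenta f)) {t e₀ c : ℝ}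
    (h : ∀ e (r : ℝ), f (timePoint p e) ≤ r → c + t * (e - e₀) ≤ r) :
    ∃ x, ∀ v (r : ℝ), f v ≤ r → c + ⟪timePoint x t, v - timePoint p e₀⟫ ≤ r := by
  obtain ⟨x, hx⟩ := Convex.exists_inner_le_snd
    (G := {g : EuclideanSpace ℝ (Fin n) × ℝ |
      ∃ e : ℝ, f (timePoint (p + g.1) e) ≤ ((g.2 + c + t * (e - e₀) : ℝ) : EReal)})
    (by
      rintro ⟨u, ρ⟩ ⟨e, hu⟩ ⟨u', ρ'⟩ ⟨e', hu'⟩ a b ha hb hab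
      refine ⟨a * e + b * e', ?_⟩
      have := hf.le_combo hu hu' ha hb hab
      rw [timePoint_combo] at this
      change f (timePoint (p + (a • u + b • u')) (a * e + b * e')) ≤
        ((a * ρ + b * ρ' + c + t * (a * e + b * e' - e₀) : ℝ) : EReal)
      obtain rfl : b = 1 - a := by linarith
      convert this using 2
      · congr 1
        module
      · ring)
    (by
      rintro r ⟨e, hr⟩
      rw [add_zero] at hr
      linarith [h e _ hr])
    (by
      rintro ⟨u, ρ⟩ ⟨e, hu⟩
      obtain ⟨s, hs, e', r', h'⟩ := exists_prolongation_mem hp (y := p + u) ⟨e, _, hu⟩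
      refine ⟨s, hs, r' - c - t * (e' - e₀), e', ?_⟩
      change f (timePoint (p + -s • u) e') ≤ _
      convert h' using 2
      · congr 1
        module
      · ring)
  refine ⟨x, fun v r hv => ?_⟩
  obtain ⟨p', e, rfl⟩ := exists_timePoint v
  have := hx (p' - p, r - c - t * (e - e₀)) ⟨e, by
    change f (timePoint (p + (p' - p)) e) ≤
      ((r - c - t * (e - e₀) + c + t * (e - e₀) : ℝ) : EReal)
    convert hv using 2
    · congr 1
      module
    · ring⟩
  simp only at this
  rw [timePoint_sub, inner_timePoint]
  linarith

variable {J H : EuclideanSpace ℝ (Fin n) → EReal} {S : SpaceTime n 1 → EReal}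

theorem legendre_timePoint_le_iff {p : EuclideanSpace ℝ (Fin n)} {e r : ℝ} :
    legendre S (timePoint p e) ≤ r ↔
      ∀ x (t c : ℝ), S (timePoint x t) ≤ c → ⟪p, x⟫ + e * t - c ≤ r := by
  rw [legendre_le_coe_iff]
  refine ⟨fun h x t c hx => ?_, fun h v c hv => ?_⟩
  · rw [← inner_timePoint]
    exact h _ _ hx
  · obtain ⟨x, t, rfl⟩ := exists_timePoint v
    rw [inner_timePoint]
    exact h _ _ _ hv

theorem isClosed_setOf_legendre_le (p : EuclideanSpace ℝ (Fin n)) (r : ℝ) :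
    IsClosed {e : ℝ | legendre S (timePoint p e) ≤ r} := by
  simp only [legendre_timePoint_le_iff, Set.ofPred_forall]
  refine isClosed_iInter fun x => isClosed_iInter fun t => isClosed_iInter fun c =>
    isClosed_iInter fun _ => isClosed_le (by fun_prop) continuous_const

namespace IsConvexHJSolution

theorem time_nonneg (hS : IsConvexHJSolution J (fun _ => H) S) {x : EuclideanSpace ℝ (Fin n)}
    {t r : ℝ} (h : S (timePoint x t) ≤ r) : 0 ≤ t := by
  by_contra! ht
  rw [timePoint, hS.eq_top _ _ ⟨0, ht⟩, top_le_iff] at h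
  exact EReal.coe_ne_top r h

theorem legendre_mono (hS : IsConvexHJSolution J (fun _ => H) S) {p : EuclideanSpace ℝ (Fin n)}
    {e e' r : ℝ} (h : legendre S (timePoint p e) ≤ r) (he : e' ≤ e) :
    legendre S (timePoint p e') ≤ r := by
  rw [legendre_timePoint_le_iff] at *
  intro x t c hx
  have := mul_le_mul_of_nonneg_right he (hS.time_nonneg hx)
  linarith [h x t c hx]

theorem legendre_initial_le (hS : IsConvexHJSolution J (fun _ => H) S)
    {p : EuclideanSpace ℝ (Fin n)} {e r : ℝ} (h : legendre S (timePoint p e) ≤ r) :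
    legendre J p ≤ r := by
  refine legendre_le_coe_iff.2 fun x c hx => ?_
  rw [← hS.initial, ← timePoint_zero] at hx
  have := legendre_timePoint_le_iff.1 h x 0 c hx
  linarith

/-- The momenta of `S^*` and the domain of `J^*` differ by boundary points only, because `J` is the
Legendre transform of the infimum of `S^*` over the energy variable. -/
theorem ri_effDom_subset_ri_momenta (hS : IsConvexHJSolution J (fun _ => H) S) (hJ : GammaZero J) :
    intrinsicInterior ℝ (effDom (legendre J)) ⊆ intrinsicInterior ℝ (momenta (legendre S)) := by
  obtain ⟨y, j, hy⟩ := hJ.effDom_nonempty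
  have hbot : ∀ p, legendre J p ≠ ⊥ := legendre_ne_bot hy.le
  have hconv : Convex ℝ (momenta (legendre S)) := convex_momenta (convex_epigraph_legendre S)
  refine hconv.intrinsicInterior_subset_of_subset_closure ?_ ?_ ?_
  · obtain ⟨q, r, hq⟩ := hS.gamma.exists_legendre_le
    exact ⟨q.fst, q.snd 0, r, by rwa [timePoint_fst_snd]⟩
  · rintro p ⟨e, r, h⟩
    exact (mem_effDom_iff (hbot p)).2 ⟨r, hS.legendre_initial_le h⟩
  · intro p hp
    obtain ⟨r, hr⟩ := (mem_effDom_iff (hbot p)).1 hp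
    refine mem_closure_of_legendre_le hconv (y := y) (j := j) (fun x α hα s hs => ?_) hr
    rw [← hS.initial, ← timePoint_zero, ← hS.gamma.legendre_legendre, legendre_timePoint_le_iff]
    intro q e c hq
    have h1 := legendre_timePoint_le_iff.1 hq y 0 j
      (by rw [timePoint_zero, hS.initial]; exact hy.le)
    have h2 := mul_le_mul_of_nonneg_left (hα q ⟨e, c, hq⟩) hs
    rw [inner_add_left, real_inner_smul_left, real_inner_comm q y]
    linarith

/-- A supporting line of positive slope in the energy variable touches `S^*` at the energy `-H p`
only. -/
theorem energy_eq_of_slope (hS : IsConvexHJSolution J (fun _ => H) S)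
    {p : EuclideanSpace ℝ (Fin n)} (hp : p ∈ intrinsicInterior ℝ (momenta (legendre S)))
    {t e c : ℝ} (ht : 0 < t) (hc : legendre S (timePoint p e) ≤ c)
    (h : ∀ e' (r : ℝ), legendre S (timePoint p e') ≤ r → c + t * (e' - e) ≤ r) :
    (e : EReal) + H p = 0 := by
  obtain ⟨x, hx⟩ := exists_inner_le_of_slice (convex_epigraph_legendre S) hp h
  exact hS.hj p _ x _ (fun _ => ht) (hS.gamma.mem_subdiff_of_legendre hc hx).2 0

/-- At a finite value of `S^*` which is minimal in the energy variable, `S^*` is at most `J^*`. -/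
theorem le_legendre_initial (hS : IsConvexHJSolution J (fun _ => H) S)
    {p : EuclideanSpace ℝ (Fin n)} (hp : p ∈ intrinsicInterior ℝ (momenta (legendre S)))
    {e c j : ℝ} (hc : legendre S (timePoint p e) ≤ c)
    (h : ∀ e' (r : ℝ), legendre S (timePoint p e') ≤ r → c ≤ r) (hj : legendre J p ≤ j) :
    c ≤ j := by
  obtain ⟨x, hx⟩ := exists_inner_le_of_slice (convex_epigraph_legendre S) hp (t := 0) (e₀ := e)
    (by simpa using h)
  have hSx := (hS.gamma.mem_subdiff_of_legendre hc hx).1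
  rw [timePoint_zero, hS.initial, ← timePoint_zero, inner_timePoint] at hSx
  have := legendre_le_coe_iff.1 hj x _ hSx.le
  rw [real_inner_comm] at this
  linarith

/-- Below an energy where `S^*` is finite, there is a supporting hyperplane. -/
theorem exists_support (hS : IsConvexHJSolution J (fun _ => H) S)
    {p : EuclideanSpace ℝ (Fin n)} (hp : p ∈ intrinsicInterior ℝ (momenta (legendre S)))
    {e e₁ r₁ c : ℝ} (he : e < e₁) (h₁ : legendre S (timePoint p e₁) ≤ r₁)
    (hc : legendre S (timePoint p e) = c) :
    ∃ q, ∀ v (r : ℝ), legendre S v ≤ r → c + ⟪q, v - timePoint p e⟫ ≤ r := by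
  refine exists_subgradient_of_core (convex_epigraph_legendre S) hc fun v r hv => ?_
  obtain ⟨p', e', rfl⟩ := exists_timePoint v
  obtain ⟨s, hs, e₂, r₂, h₂⟩ := exists_prolongation_mem hp (y := p') ⟨e', r, hv⟩
  -- Mix a small part `θ` of the prolongation of the segment into `(p, e₁)`. The energy stays above
  -- the required one, and `S^*` is monotone in the energy.
  set K := e₂ - e₁ + s * (e' - e) with hK
  have hpos : 0 < e₁ - e + |K| := by have := abs_nonneg K; linarith
  set θ := (e₁ - e) / (e₁ - e + |K|) with hθ
  have hθ0 : 0 < θ := div_pos (by linarith) hpos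
  have hθ1 : θ ≤ 1 := (div_le_one hpos).2 (by linarith [abs_nonneg K])
  have hθK : -(e₁ - e) ≤ θ * K := by
    have h1 : θ * (e₁ - e + |K|) = e₁ - e := div_mul_cancel₀ _ hpos.ne'
    have h2 := mul_le_mul_of_nonneg_left (neg_abs_le K) hθ0.le
    have h3 : 0 ≤ θ * (e₁ - e) := mul_nonneg hθ0.le (by linarith)
    linarith
  have h := (convex_epigraph_legendre S).le_combo h₁ h₂ (a := 1 - θ) (b := θ) (by linarith)
    hθ0.le (by ring)
  rw [timePoint_combo] at h
  refine ⟨θ * s, by positivity, _,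
    le_of_eq_of_le ?_ (hS.legendre_mono h (e' := e - θ * s * (e' - e)) ?_)⟩
  · congr 1
    change timePoint (p - (θ * s) • (p' - p)) (e - θ * s * (e' - e)) = _
    congr 1
    module
  · rw [hK] at hθK
    linarith

/-- On the relative interior, `S^* (p, e)` is at most `J^* p` wherever it is finite: below a finite
energy, a supporting hyperplane with nonzero time component exists at the energy `-H p` only, so
`S^* (p, ·)` is minimal at all other energies. -/
theorem legendre_le_of_finite (hS : IsConvexHJSolution J (fun _ => H) S)
    {p : EuclideanSpace ℝ (Fin n)} (hp : p ∈ intrinsicInterior ℝ (momenta (legendre S)))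
    {e₁ r₁ j : ℝ} (h₁ : legendre S (timePoint p e₁) ≤ r₁) (hj : legendre J p ≤ j) :
    legendre S (timePoint p e₁) ≤ j := by
  have hlt : ∀ e < e₁, ¬((e : EReal) + H p = 0) → legendre S (timePoint p e) ≤ j := by
    intro e he hne
    obtain ⟨v₀, c₀, hv₀⟩ := hS.gamma.effDom_nonempty
    obtain ⟨c, hc⟩ := (mem_effDom_iff (legendre_ne_bot hv₀.le _)).2
      ⟨r₁, hS.legendre_mono h₁ he.le⟩
    obtain ⟨q, hq⟩ := hS.exists_support hp he h₁ hc
    obtain ⟨x, t, rfl⟩ := exists_timePoint q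
    obtain ⟨hval, hsub⟩ := hS.gamma.mem_subdiff_of_legendre hc.le hq
    rcases (hS.time_nonneg hval.le).eq_or_lt with rfl | ht
    · rw [hc, EReal.coe_le_coe_iff]
      refine hS.le_legendre_initial hp hc.le (fun e' r hr => ?_) hj
      have := hq _ _ hr
      rw [timePoint_sub, inner_timePoint] at this
      simpa using this
    · exact absurd (hS.hj p _ x _ (fun _ => ht) hsub 0) hne
  -- At most one energy is excluded, so monotonicity covers it.
  have hall : Set.Iio e₁ ⊆ {e : ℝ | legendre S (timePoint p e) ≤ j} := by
    intro e he
    obtain ⟨e₂, h12, h2⟩ := exists_between (Set.mem_Iio.1 he)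
    by_cases h : (e₂ : EReal) + H p = 0
    · obtain ⟨e₃, h23, h3⟩ := exists_between h2
      refine hS.legendre_mono (hlt e₃ h3 fun h' => ?_) (h12.trans h23).le
      rw [EReal.coe_add_eq_zero_iff] at h h'
      rw [h, EReal.coe_eq_coe_iff] at h'
      linarith
    · exact hS.legendre_mono (hlt e₂ h2 h) h12.le
  have := (isClosed_setOf_legendre_le (S := S) p j).closure_subset_iff.2 hall
  rw [closure_Iio] at this
  exact this Set.self_mem_Iic

/-- For `p` in the relative interior of the domain of `J^*`, the function `S^* (p, ·)` equals
`J^* p` on the half-line `e ≤ -H p`, and `⊤` elsewhere. -/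
theorem exists_energy (hS : IsConvexHJSolution J (fun _ => H) S) (hJ : GammaZero J)
    (hfin : FiniteAtPositiveTime S) {p : EuclideanSpace ℝ (Fin n)}
    (hp : p ∈ intrinsicInterior ℝ (effDom (legendre J))) {j : ℝ} (hj : legendre J p = j) :
    ∃ b : ℝ, H p = ((-b : ℝ) : EReal) ∧
      ∀ e r : ℝ, legendre S (timePoint p e) ≤ r ↔ e ≤ b ∧ j ≤ r := by
  have hp' := hS.ri_effDom_subset_ri_momenta hJ hp
  set E := {e : ℝ | legendre S (timePoint p e) ≤ j}
  obtain ⟨e₁, r₁, h₁⟩ := intrinsicInterior_subset hp'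
  have hne : E.Nonempty := ⟨e₁, hS.legendre_le_of_finite hp' h₁ hj.le⟩
  have hbdd : BddAbove E := by
    obtain ⟨x₀, t₀, ht₀, hx₀⟩ := hfin
    obtain ⟨c₀, hc₀⟩ : stPoint x₀ t₀ ∈ effDom S :=
      ⟨_, (EReal.coe_toReal hx₀ (hS.gamma.ne_bot _)).symm⟩
    refine ⟨(j + c₀ - ⟪p, x₀⟫) / t₀ 0, fun e he => ?_⟩
    rw [le_div_iff₀ (ht₀ 0)]
    have hst : stPoint x₀ t₀ = timePoint x₀ (t₀ 0) := (timePoint_fst_snd _).symm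
    rw [hst] at hc₀
    linarith [legendre_timePoint_le_iff.1 he x₀ (t₀ 0) c₀ hc₀.le]
  have hb : sSup E ∈ E := (isClosed_setOf_legendre_le p j).csSup_mem hne hbdd
  have hjle : ∀ e r : ℝ, legendre S (timePoint p e) ≤ r → j ≤ r := fun e r h => by
    have := hS.legendre_initial_le h
    rwa [hj, EReal.coe_le_coe_iff] at this
  have hle : ∀ e r : ℝ, legendre S (timePoint p e) ≤ r → e ≤ sSup E := fun e r h =>
    le_csSup hbdd (hS.legendre_le_of_finite hp' h hj.le)
  refine ⟨sSup E, EReal.coe_add_eq_zero_iff.1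
    (hS.energy_eq_of_slope hp' one_pos hb fun e r h => ?_), fun e r =>
    ⟨fun h => ⟨hle e r h, hjle e r h⟩, fun h => ?_⟩⟩
  · linarith [hle e r h, hjle e r h]
  · exact hS.legendre_mono (hb.trans (EReal.coe_le_coe_iff.2 h.2)) h.1

end IsConvexHJSolution

end SingleTime

/-! ### The Hopf formula and the Hamiltonian -/

section HopfFormula

variable {n : ℕ} {J H : EuclideanSpace ℝ (Fin n) → EReal} {S : SpaceTime n 1 → EReal}

namespace IsConvexHJSolution

theorem hopfDual_eq_of_mem (hS : IsConvexHJSolution J (fun _ => H) S) (hJ : GammaZero J)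
    (hfin : FiniteAtPositiveTime S) {p : EuclideanSpace ℝ (Fin n)}
    (hp : p ∈ intrinsicInterior ℝ (effDom (legendre J))) (e : ℝ) :
    hopfDual J H (timePoint p e) = legendre S (timePoint p e) := by
  obtain ⟨j, hj⟩ := intrinsicInterior_subset hp
  obtain ⟨b, hb, hiff⟩ := hS.exists_energy hJ hfin hp hj
  have hH : -H p = b := by
    rw [hb, ← EReal.coe_neg, neg_neg]
  have hval : hopfDual J H (timePoint p e) = j + indic (e ≤ b) := by
    change legendre J p + indic ((e : EReal) ≤ -H p) + indic (p ∈ _) = _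
    rw [hj, hH, EReal.coe_le_coe_iff]
    simp [indic, hp]
  rw [hval]
  refine le_antisymm ?_ ?_ <;> refine EReal.le_iff_forall_coe.2 fun r hr => ?_
  · obtain ⟨h1, h2⟩ := (hiff e r).1 hr
    simpa [indic, h1] using h2
  · rw [hiff]
    by_cases h : e ≤ b
    · exact ⟨h, by simpa [indic, h] using hr⟩
    · simp [indic, h] at hr

/-- The Hopf formula. Discarding the momenta outside the relative interior of the domain of `J^*`
does not change the Legendre transform of `S^*`, by convexity along segments that start in the
relative interior. -/
theorem eq_legendre_hopfDual (hS : IsConvexHJSolution J (fun _ => H) S) (hJ : GammaZero J)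
    (hfin : FiniteAtPositiveTime S) : S = legendre (hopfDual J H) := by
  obtain ⟨y, i, hy⟩ := hJ.effDom_nonempty
  have hbot : ∀ p, legendre J p ≠ ⊥ := legendre_ne_bot hy.le
  have hdom : Convex ℝ (effDom (legendre J)) := convex_effDom (convex_epigraph_legendre J) hbot
  conv_lhs => rw [← hS.gamma.legendre_legendre]
  funext z
  refine le_antisymm ?_ ?_ <;> refine EReal.le_iff_forall_coe.2 fun r hr => ?_
  · refine legendre_le_coe_iff.2 fun q c hq => ?_
    obtain ⟨p, e, rfl⟩ := exists_timePoint q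
    have hpJ : p ∈ effDom (legendre J) := (mem_effDom_iff (hbot p)).2 ⟨c, hS.legendre_initial_le hq⟩
    obtain ⟨p₀, hp₀⟩ := Set.Nonempty.intrinsicInterior hdom ⟨p, hpJ⟩
    obtain ⟨e₀, c₀, h₀⟩ := intrinsicInterior_subset (hS.ri_effDom_subset_ri_momenta hJ hp₀)
    have hseg : ∀ s : ℝ, 0 < s → s < 1 →
        (1 - s) * (⟪z, timePoint p₀ e₀⟫ - c₀) + s * (⟪z, timePoint p e⟫ - c) ≤ r := by
      intro s hs hs1
      have h1 := (convex_epigraph_legendre S).le_combo h₀ hq (a := 1 - s) (b := s) (by linarith)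
        hs.le (by ring)
      have hri := hdom.combo_intrinsicInterior_closure_mem hp₀ (subset_closure hpJ) (a := 1 - s)
        (b := s) (by linarith) hs.le (by ring)
      rw [timePoint_combo, ← hS.hopfDual_eq_of_mem hJ hfin hri, ← timePoint_combo] at h1
      have h2 := legendre_le_coe_iff.1 hr _ _ h1
      rw [inner_add_right, real_inner_smul_right, real_inner_smul_right] at h2
      linarith
    have hlim : Filter.Tendsto (fun s : ℝ => (1 - s) * (⟪z, timePoint p₀ e₀⟫ - c₀) +
        s * (⟪z, timePoint p e⟫ - c)) (nhdsWithin 1 (Set.Iio 1))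
        (nhds (⟪z, timePoint p e⟫ - c)) := by
      have : Continuous fun s : ℝ => (1 - s) * (⟪z, timePoint p₀ e₀⟫ - c₀) +
        s * (⟪z, timePoint p e⟫ - c) := by fun_prop
      simpa using (this.tendsto 1).mono_left nhdsWithin_le_nhds
    refine le_of_tendsto hlim ?_
    filter_upwards [Ioo_mem_nhdsLT (zero_lt_one (α := ℝ))] with s hs using hseg s hs.1 hs.2
  · refine legendre_le_coe_iff.2 fun q c hq => ?_
    obtain ⟨p, e, rfl⟩ := exists_timePoint q
    by_cases hp : p ∈ intrinsicInterior ℝ (effDom (legendre J))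
    · rw [hS.hopfDual_eq_of_mem hJ hfin hp] at hq
      exact legendre_le_coe_iff.1 hr _ _ hq
    · -- Neither of the first two summands of the Hopf dual is `⊥`, so the indicator makes it `⊤`.
      have htop : hopfDual J H (timePoint p e) = ⊤ := by
        change legendre J p + indic ((e : EReal) ≤ -H p) + indic (p ∈ _) = ⊤
        rw [indic, indic, if_neg hp]
        refine EReal.add_top_of_ne_bot (EReal.add_ne_bot_iff.2 ⟨hbot p, ?_⟩)
        split_ifs <;> simp
      rw [htop, top_le_iff] at hq
      exact absurd hq (EReal.coe_ne_top c)

theorem hamiltonian_ne_top_ne_bot (hS : IsConvexHJSolution J (fun _ => H) S) (hJ : GammaZero J)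
    (hfin : FiniteAtPositiveTime S) {p : EuclideanSpace ℝ (Fin n)}
    (hp : p ∈ intrinsicInterior ℝ (effDom (legendre J))) : H p ≠ ⊤ ∧ H p ≠ ⊥ := by
  obtain ⟨j, hj⟩ := intrinsicInterior_subset hp
  obtain ⟨b, hb, -⟩ := hS.exists_energy hJ hfin hp hj
  rw [hb]
  exact ⟨EReal.coe_ne_top _, EReal.coe_ne_bot _⟩

/-- The Hamiltonian is convex because the graph of `-H` bounds the convex set `dom S^*`. -/
theorem convexOn_hamiltonian (hS : IsConvexHJSolution J (fun _ => H) S) (hJ : GammaZero J)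
    (hfin : FiniteAtPositiveTime S) :
    ConvexOn ℝ (intrinsicInterior ℝ (effDom (legendre J))) (fun p => (H p).toReal) := by
  obtain ⟨y, i, hy⟩ := hJ.effDom_nonempty
  have hri : Convex ℝ (intrinsicInterior ℝ (effDom (legendre J))) :=
    (convex_effDom (convex_epigraph_legendre J) (legendre_ne_bot hy.le)).intrinsicInterior
  have henergy : ∀ p ∈ intrinsicInterior ℝ (effDom (legendre J)), ∃ j : ℝ,
      ∀ e r : ℝ, legendre S (timePoint p e) ≤ r ↔ e ≤ -(H p).toReal ∧ j ≤ r := by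
    intro p hp
    obtain ⟨j, hj⟩ := intrinsicInterior_subset hp
    obtain ⟨b, hb, hiff⟩ := hS.exists_energy hJ hfin hp hj
    obtain rfl : b = -(H p).toReal := by rw [hb, EReal.toReal_coe, neg_neg]
    exact ⟨j, hiff⟩
  refine ⟨hri, fun p hp q hq a b ha hb hab => ?_⟩
  obtain ⟨j, hj⟩ := henergy p hp
  obtain ⟨k, hk⟩ := henergy q hq
  obtain ⟨l, hl⟩ := henergy _ (hri hp hq ha hb hab)
  have h := (convex_epigraph_legendre S).le_combo ((hj _ j).2 ⟨le_rfl, le_rfl⟩)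
    ((hk _ k).2 ⟨le_rfl, le_rfl⟩) ha hb hab
  rw [timePoint_combo] at h
  have := ((hl _ _).1 h).1
  simp only [smul_eq_mul]
  linarith

end IsConvexHJSolution

end HopfFormula

/-! ### Several times: restriction to rays -/

section MultiTime

variable {n N : ℕ}

theorem exists_stPoint (q : SpaceTime n N) : ∃ x t, q = stPoint x t := ⟨q.fst, q.snd, rfl⟩

theorem inner_stPoint (p x : EuclideanSpace ℝ (Fin n)) (E t : EuclideanSpace ℝ (Fin N)) :
    ⟪stPoint p E, stPoint x t⟫ = ⟪p, x⟫ + ⟪E, t⟫ := by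
  simp [stPoint]

/-- The linear map `(x, s) ↦ (x, s τ)` along the ray of times spanned by `τ`. -/
noncomputable def rayMap (n : ℕ) (τ : EuclideanSpace ℝ (Fin N)) :
    SpaceTime n 1 →ₗ[ℝ] SpaceTime n N where
  toFun q := stPoint q.fst (q.snd 0 • τ)
  map_add' p q := by
    change stPoint (p.fst + q.fst) ((p.snd 0 + q.snd 0) • τ) = _
    rw [add_smul]
    rfl
  map_smul' a q := by
    change stPoint (a • q.fst) ((a * q.snd 0) • τ) = _
    rw [mul_smul]
    rfl

theorem rayMap_timePoint (τ : EuclideanSpace ℝ (Fin N)) (x : EuclideanSpace ℝ (Fin n)) (s : ℝ) :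
    rayMap n τ (timePoint x s) = stPoint x (s • τ) := rfl

theorem GammaZero.comp_linearMap {U V : Type*} [NormedAddCommGroup U] [InnerProductSpace ℝ U]
    [FiniteDimensional ℝ U] [NormedAddCommGroup V] [InnerProductSpace ℝ V] {f : V → EReal}
    (hf : GammaZero f) (A : U →ₗ[ℝ] V) (hA : ∃ u, f (A u) ≠ ⊤) :
    GammaZero (fun u => f (A u)) where
  ne_bot u := hf.ne_bot _
  proper := hA
  convex x y a ha ha1 := by
    rw [map_add, map_smul, map_smul]
    exact hf.convex _ _ a ha ha1
  lsc := hf.lsc.comp A.continuous_of_finiteDimensional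

/-- The chain rule for subgradients: if the range of the linear map `A` meets the relative interior
of the domain of `f`, then each subgradient of `f ∘ A` comes from a subgradient of `f`. -/
theorem exists_subdiff_of_comp {U V : Type*} [NormedAddCommGroup U] [InnerProductSpace ℝ U]
    [NormedAddCommGroup V] [InnerProductSpace ℝ V] [FiniteDimensional ℝ V] {f : V → EReal}
    (hf : GammaZero f) (A : U →ₗ[ℝ] V) {u₀ u ℓ : U} {r : ℝ}
    (hu₀ : A u₀ ∈ intrinsicInterior ℝ (effDom f)) (hr : f (A u) = r)
    (hℓ : ℓ ∈ subdiff (fun w => f (A w)) u) :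
    ∃ p ∈ subdiff f (A u), ∀ w, ⟪p, A w⟫ = ⟪ℓ, w⟫ := by
  rw [mem_subdiff_iff (f := fun w => f (A w)) hr] at hℓ
  have hconv := hf.convex_epigraph
  -- Support the infimal convolution of `f` with the affine function defined by `ℓ` on the range.
  obtain ⟨p, hp⟩ := Convex.exists_inner_le_snd
    (G := {g : V × ℝ | ∃ w : U, f (A w + g.1) ≤ ((r + ⟪ℓ, w - u⟫ + g.2 : ℝ) : EReal)})
    (by
      rintro ⟨v, ρ⟩ ⟨w, h⟩ ⟨v', ρ'⟩ ⟨w', h'⟩ a b ha hb hab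
      refine ⟨a • w + b • w', ?_⟩
      have := hconv.le_combo h h' ha hb hab
      change f (A (a • w + b • w') + (a • v + b • v')) ≤
        ((r + ⟪ℓ, a • w + b • w' - u⟫ + (a * ρ + b * ρ') : ℝ) : EReal)
      obtain rfl : b = 1 - a := by linarith
      convert this using 2
      · simp only [map_add, map_smul]
        module
      · simp only [inner_sub_right, inner_add_right, real_inner_smul_right]
        ring)
    (by
      rintro c ⟨w, h⟩
      rw [add_zero] at h
      linarith [hℓ w _ h])
    (by
      rintro ⟨v, ρ⟩ ⟨w, h⟩
      obtain ⟨s, hs, hmem⟩ := exists_prolongation_mem hu₀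
        ((mem_effDom_iff (hf.ne_bot _)).2 ⟨_, h⟩)
      obtain ⟨c, hc⟩ := hmem
      refine ⟨s, hs, c - r - ⟪ℓ, u₀ - s • (w - u₀) - u⟫, u₀ - s • (w - u₀), ?_⟩
      change f (A (u₀ - s • (w - u₀)) + -s • v) ≤ _
      refine le_of_eq_of_le (congrArg f ?_) (hc.le.trans (EReal.coe_le_coe_iff.2 (by simp)))
      simp only [map_sub, map_smul]
      module)
  have hrange : ∀ w, ⟪p, A w⟫ ≤ ⟪ℓ, w⟫ := fun w => by
    refine hp (A w, ⟪ℓ, w⟫) ⟨u - w, ?_⟩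
    change f (A (u - w) + A w) ≤ ((r + ⟪ℓ, u - w - u⟫ + ⟪ℓ, w⟫ : ℝ) : EReal)
    rw [← map_add, sub_add_cancel, hr, EReal.coe_le_coe_iff]
    simp
  have hrange' : ∀ w, ⟪p, A w⟫ = ⟪ℓ, w⟫ := fun w => by
    have := hrange (-w)
    rw [map_neg, inner_neg_right, inner_neg_right] at this
    exact le_antisymm (hrange w) (by linarith)
  refine ⟨p, (mem_subdiff_iff hr).2 fun v c hv => ?_, hrange'⟩
  have := hp (v - A u, c - r) ⟨u, by
    change f (A u + (v - A u)) ≤ ((r + ⟪ℓ, u - u⟫ + (c - r) : ℝ) : EReal)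
    simpa using hv⟩
  simp only at this
  linarith

variable {J : EuclideanSpace ℝ (Fin n) → EReal} {H : Fin N → EuclideanSpace ℝ (Fin n) → EReal}
  {S S' : SpaceTime n N → EReal}

namespace IsConvexHJSolution

theorem hj_comp_rayMap (hS : IsConvexHJSolution J H S) (hJ : GammaZero J)
    {τ : EuclideanSpace ℝ (Fin N)} (hτ : ∀ j, 0 < τ j) {x₀ : EuclideanSpace ℝ (Fin n)}
    (hri : stPoint x₀ τ ∈ intrinsicInterior ℝ (effDom S)) {p x : EuclideanSpace ℝ (Fin n)}
    {E t : EuclideanSpace ℝ (Fin 1)} (ht : 0 < t 0)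
    (hsub : stPoint p E ∈ subdiff (fun q => S (rayMap n τ q)) (stPoint x t)) :
    E 0 + ∑ j, τ j * (H j p).toReal = 0 := by
  have hx₀ : rayMap n τ (timePoint x₀ 1) ∈ intrinsicInterior ℝ (effDom S) := by
    rwa [rayMap_timePoint, one_smul]
  obtain ⟨y, hy⟩ := hJ.effDom_nonempty
  -- A subgradient at a point where the function is `⊤` would force it to be `⊤` everywhere.
  obtain ⟨r, hr⟩ : ∃ r : ℝ, S (rayMap n τ (stPoint x t)) = r := by
    refine (mem_effDom_iff (hS.gamma.ne_bot _)).2 ?_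
    by_contra hno
    have htop : S (rayMap n τ (stPoint x t)) = ⊤ := by
      by_contra h
      exact hno ⟨_, (EReal.coe_toReal h (hS.gamma.ne_bot _)).ge⟩
    have := hsub (timePoint y 0)
    simp only [htop, EReal.top_add_coe, top_le_iff, rayMap_timePoint, zero_smul,
      hS.initial] at this
    obtain ⟨c, hc⟩ := hy
    rw [hc] at this
    exact EReal.coe_ne_top c this
  obtain ⟨P, hP, hPA⟩ := exists_subdiff_of_comp hS.gamma (rayMap n τ) hx₀ hr hsub
  obtain ⟨p', E', rfl⟩ := exists_stPoint P
  have hx : ∀ w s, ⟪p', w⟫ + s * ⟪E', τ⟫ = ⟪p, w⟫ + E 0 * s := by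
    intro w s
    have := hPA (timePoint w s)
    rwa [rayMap_timePoint, inner_stPoint, real_inner_smul_right,
      show stPoint p E = timePoint p (E 0) from (timePoint_fst_snd _).symm,
      inner_timePoint] at this
  obtain rfl : p' = p := ext_inner_right ℝ fun w => by simpa using hx w 0
  have hE : E 0 = ⟪E', τ⟫ := by simpa using (hx 0 1).symm
  have hH : ∀ i, E' i = -(H i p').toReal := by
    intro i
    rw [EReal.coe_add_eq_zero_iff.1
      (hS.hj p' E' x (t 0 • τ) (fun j => mul_pos ht (hτ j)) hP i), EReal.toReal_coe, neg_neg]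
  rw [hE, PiLp.inner_apply, ← Finset.sum_add_distrib]
  refine Finset.sum_eq_zero fun i _ => ?_
  rw [hH]
  simp

theorem comp_rayMap (hS : IsConvexHJSolution J H S) (hJ : GammaZero J) [NeZero N]
    {τ : EuclideanSpace ℝ (Fin N)} (hτ : ∀ j, 0 < τ j) {x₀ : EuclideanSpace ℝ (Fin n)}
    (hri : stPoint x₀ τ ∈ intrinsicInterior ℝ (effDom S)) :
    IsConvexHJSolution J (fun _ p => ((∑ j, τ j * (H j p).toReal : ℝ) : EReal))
      (fun q => S (rayMap n τ q)) where
  gamma := by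
    obtain ⟨x, hx⟩ := hJ.proper
    refine hS.gamma.comp_linearMap (rayMap n τ) ⟨timePoint x 0, ?_⟩
    rwa [rayMap_timePoint, zero_smul, hS.initial]
  eq_top := by
    rintro x t ⟨i, ht⟩
    rw [Subsingleton.elim i 0] at ht
    have h : (t 0 • τ) 0 < 0 := mul_neg_of_neg_of_pos ht (hτ 0)
    exact hS.eq_top x (t 0 • τ) ⟨0, h⟩
  hj := by
    intro p E x t ht hsub j
    rw [Subsingleton.elim j 0, ← EReal.coe_add, EReal.coe_eq_zero]
    exact hS.hj_comp_rayMap hJ hτ hri (ht 0) hsub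
  initial := fun x => by
    change S (rayMap n τ (timePoint x 0)) = J x
    rw [rayMap_timePoint, zero_smul, hS.initial]

/-- Solutions whose domain has a given relative interior are determined there, by reduction to a
single time along rays. -/
theorem eqOn_intrinsicInterior (hS : IsConvexHJSolution J H S) (hS' : IsConvexHJSolution J H S')
    (hJ : GammaZero J) [NeZero N]
    (hdom : intrinsicInterior ℝ (effDom S') = intrinsicInterior ℝ (effDom S))
    {x : EuclideanSpace ℝ (Fin n)} {τ : EuclideanSpace ℝ (Fin N)} (hτ : ∀ j, 0 < τ j)
    (hx : stPoint x τ ∈ intrinsicInterior ℝ (effDom S)) : S' (stPoint x τ) = S (stPoint x τ) := by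
  have hfin : ∀ {T : SpaceTime n N → EReal}, stPoint x τ ∈ intrinsicInterior ℝ (effDom T) →
      FiniteAtPositiveTime (fun q => T (rayMap n τ q)) := by
    intro T hT
    obtain ⟨r, hr⟩ := intrinsicInterior_subset hT
    refine ⟨x, WithLp.toLp 2 fun _ => 1, fun _ => one_pos, ?_⟩
    change T (rayMap n τ (timePoint x 1)) ≠ ⊤
    rw [rayMap_timePoint, one_smul, hr]
    exact EReal.coe_ne_top r
  have hx' : stPoint x τ ∈ intrinsicInterior ℝ (effDom S') := hdom ▸ hx
  have h := ((hS'.comp_rayMap hJ hτ hx').eq_legendre_hopfDual hJ (hfin hx')).trans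
    ((hS.comp_rayMap hJ hτ hx).eq_legendre_hopfDual hJ (hfin hx)).symm
  have h1 := congrFun h (timePoint x 1)
  simpa only [rayMap_timePoint, one_smul] using h1

theorem pos_of_mem_intrinsicInterior (hS : IsConvexHJSolution J H S)
    (hfin : FiniteAtPositiveTime S) {x : EuclideanSpace ℝ (Fin n)} {τ : EuclideanSpace ℝ (Fin N)}
    (hx : stPoint x τ ∈ intrinsicInterior ℝ (effDom S)) (j : Fin N) : 0 < τ j := by
  obtain ⟨x₀, t₀, ht₀, hx₀⟩ := hfin
  obtain ⟨s, hs, c, hc⟩ := exists_prolongation_mem hx (y := stPoint x₀ t₀)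
    ⟨_, (EReal.coe_toReal hx₀ (hS.gamma.ne_bot _)).symm⟩
  by_contra! hneg
  have htop := hS.eq_top (x - s • (x₀ - x)) (τ - s • (t₀ - τ)) ⟨j, by
    have h1 := mul_pos hs (ht₀ j)
    have h2 := mul_nonneg hs.le (neg_nonneg.2 hneg)
    simp only [PiLp.sub_apply, PiLp.smul_apply, smul_eq_mul]
    linarith⟩
  exact EReal.coe_ne_top c (hc.symm.trans htop)

end IsConvexHJSolution

/-- A comparison made on the relative interior of the domain of `f` extends to its boundary, along
segments that start in the relative interior. -/
theorem GammaZero.le_of_eqOn_intrinsicInterior {V : Type*} [NormedAddCommGroup V]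
    [InnerProductSpace ℝ V] [FiniteDimensional ℝ V] {f g : V → EReal} (hf : GammaZero f)
    (hg : GammaZero g) (h : Set.EqOn g f (intrinsicInterior ℝ (effDom f))) : g ≤ f := by
  intro x
  refine EReal.le_iff_forall_coe.2 fun r hr => ?_
  have hdom := convex_effDom hf.convex_epigraph hf.ne_bot
  have hx : x ∈ effDom f := (mem_effDom_iff (hf.ne_bot x)).2 ⟨r, hr⟩
  obtain ⟨x₀, hx₀⟩ := Set.Nonempty.intrinsicInterior hdom ⟨x, hx⟩
  obtain ⟨r₀, hr₀⟩ := intrinsicInterior_subset hx₀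
  refine hg.lsc.le_of_segment (x₀ := x₀) (a := r₀) fun s hs hs1 => ?_
  rw [h (hdom.combo_intrinsicInterior_closure_mem hx₀ (subset_closure hx) (a := 1 - s) (b := s)
    (by linarith) hs.le (by ring))]
  exact hf.convex_epigraph.le_combo hr₀.le hr (by linarith) hs.le (by ring)

theorem IsConvexHJSolution.eq_of_intrinsicInterior_eq [NeZero N]
    {J : EuclideanSpace ℝ (Fin n) → EReal} {H : Fin N → EuclideanSpace ℝ (Fin n) → EReal}
    {S S' : SpaceTime n N → EReal} (hJ : GammaZero J) (hS : IsConvexHJSolution J H S)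
    (hfin : FiniteAtPositiveTime S) (hS' : IsConvexHJSolution J H S')
    (hdom : intrinsicInterior ℝ (effDom S') = intrinsicInterior ℝ (effDom S)) : S' = S := by
  have h : Set.EqOn S' S (intrinsicInterior ℝ (effDom S)) := by
    intro q hq
    obtain ⟨x, τ, rfl⟩ := exists_stPoint q
    exact hS.eqOn_intrinsicInterior hS' hJ hdom (hS.pos_of_mem_intrinsicInterior hfin hq) hq
  refine le_antisymm (hS.gamma.le_of_eqOn_intrinsicInterior hS'.gamma h)
    (hS'.gamma.le_of_eqOn_intrinsicInterior hS.gamma ?_)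
  rw [hdom]
  exact h.symm

end MultiTime

theorem corollary4p3 (n : ℕ) (J : EuclideanSpace ℝ (Fin n) → EReal) (hJ : GammaZero J) :
    -- single time
    (∀ (H : EuclideanSpace ℝ (Fin n) → EReal) (S : SpaceTime n 1 → EReal),
      IsConvexHJSolution J (fun _ : Fin 1 => H) S → FiniteAtPositiveTime S →
        (∀ S' : SpaceTime n 1 → EReal, IsConvexHJSolution J (fun _ : Fin 1 => H) S' →
          FiniteAtPositiveTime S' → S' = S) ∧
        S = legendre (hopfDual J H) ∧
        (∀ p ∈ intrinsicInterior ℝ (effDom (legendre J)), H p ≠ ⊤ ∧ H p ≠ ⊥) ∧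
        ConvexOn ℝ (intrinsicInterior ℝ (effDom (legendre J))) (fun p => (H p).toReal)) ∧
    -- multiple times
    (∀ (N : ℕ), 1 < N → ∀ (H : Fin N → EuclideanSpace ℝ (Fin n) → EReal)
      (S S' : SpaceTime n N → EReal),
      IsConvexHJSolution J H S → FiniteAtPositiveTime S → IsConvexHJSolution J H S' →
        intrinsicInterior ℝ (effDom S') = intrinsicInterior ℝ (effDom S) → S' = S) := by
  refine ⟨fun H S hS hfin => ?_, fun N hN H S S' hS hfin hS' hdom => ?_⟩
  · have hHopf := hS.eq_legendre_hopfDual hJ hfin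
    exact ⟨fun S' hS' hfin' => (hS'.eq_legendre_hopfDual hJ hfin').trans hHopf.symm, hHopf,
      fun p hp => hS.hamiltonian_ne_top_ne_bot hJ hfin hp, hS.convexOn_hamiltonian hJ hfin⟩
  · have : NeZero N := ⟨by omega⟩
    exact hS.eq_of_intrinsicInterior_eq hJ hfin hS' hdom
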